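/- Let $\mathbb K$ be $\mathbb R$ or $\mathbb C$ and $\mathbb N=\{0,1,2,\dots\}$. Let $A=(a_{j,k})_{j,k\in\mathbb N}$ be a Köthe matrix with nonzero entries, that is, a family of positive real numbers with $a_{j,k}\le a_{j,k+1}$ for all $j,k$, and let $p\in\{0\}\cup[1,\infty)$. The Köthe sequence space $\lambda_p(A,\mathbb N)$ is the following Fréchet space. If $p\ge 1$, it is $$\lambda_p(A,\mathbb N)=\Big\{(x_j)\in\mathbb K^{\mathbb N}:\ \sum_{j}|a_{j,k}x_j|^p<\infty\ \text{ for all } k\Big\},\qquad \|x\|_k=\Big(\sum_j|a_{j,k}x_j|^p\Big)^{1/p};$$ if $p=0$, it is $$\lambda_0(A,\mathbb N)=\Big\{(x_j)\in\mathbb K^{\mathbb N}:\ \lim_{j\to\infty}a_{j,k}x_j=0\ \text{ for all } k\Big\},\qquad \|x\|_k=\sup_j|a_{j,k}x_j|.$$ In both cases it carries the topology defined by the seminorms $\|\cdot\|_k$, $k\in\mathbb N$. Let $d$ be any translation-invariant metric that induces this topology. Let $w=(w_j)_{j\in\mathbb N}$ be a sequence of nonzero scalars in $\mathbb K$ such that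 the unilateral weighted backward shift $B_w((x_j)_{j})=(w_jx_{j+1})_{j}$ maps $\lambda_p(A,\mathbb N)$ into itself. Then $B_w$ is Li–Yorke chaotic on $\lambda_p(A,\mathbb N)$, that is, there is an uncountable set $S\subset\lambda_p(A,\mathbb N)$ such that $$\liminf_{n\to\infty}d(B_w^nx,B_w^ny)=0\quad\text{and}\quad\limsup_{n\to\infty}d(B_w^nx,B_w^ny)>0\qquad\text{for all distinct }x,y\in S,$$ if and only if there exists $k\in\mathbb N$ such that $$\sup\Big\{\frac{a_{i,k}\,|w_i\cdots w_j|}{a_{j+1,\ell}}:\ i,j\in\mathbb N,\ i\le j\Big\}=\infty\qquad\text{for all }\ell\in\mathbb N.$$ -/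

import Mathlib

open Filter Topology

noncomputable section

/-- `(x, y)` is a Li-Yorke pair for `f`. The limits are taken in `[0, ∞]`, so that they are
meaningful for unbounded sequences of distances as well. -/
def IsLiYorkePair {M : Type*} [MetricSpace M] (f : M → M) (x y : M) : Prop :=
  liminf (fun n : ℕ => edist (f^[n] x) (f^[n] y)) atTop = 0 ∧
    0 < limsup (fun n : ℕ => edist (f^[n] x) (f^[n] y)) atTop

/-- `f` is Li-Yorke chaotic: it has an uncountable scrambled set. -/
def LiYorkeChaotic {M : Type*} [MetricSpace M] (f : M → M) : Prop :=
  ∃ S : Set M, ¬ S.Countable ∧ ∀ x ∈ S, ∀ y ∈ S, x ≠ y → IsLiYorkePair f x y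

/-- `A = (a_{j,k})` is a Köthe matrix. -/
structure IsKotheMatrix (A : ℕ → ℕ → ℝ) : Prop where
  exists_pos : ∀ j, ∃ k, 0 < A j k
  nonneg : ∀ j k, 0 ≤ A j k
  le_succ : ∀ j k, A j k ≤ A j (k + 1)

/-- The membership condition of `λ_p(A, ℕ)`; the exponent `p = 0` stands for the `c₀` case. -/
def KotheMem {𝕜 : Type*} [RCLike 𝕜] (p : ℝ) (A : ℕ → ℕ → ℝ) (x : ℕ → 𝕜) : Prop :=
  if p = 0 then ∀ k, Tendsto (fun j => (A j k : 𝕜) * x j) atTop (𝓝 0)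
  else ∀ k, Summable (fun j => ‖(A j k : 𝕜) * x j‖ ^ p)

/-- The `k`-th seminorm `‖x‖_k` of `λ_p(A, ℕ)`. -/
def kotheNorm {𝕜 : Type*} [RCLike 𝕜] (p : ℝ) (A : ℕ → ℕ → ℝ) (k : ℕ) (x : ℕ → 𝕜) : ℝ :=
  if p = 0 then ⨆ j, ‖(A j k : 𝕜) * x j‖
  else (∑' j, ‖(A j k : 𝕜) * x j‖ ^ p) ^ (1 / p)

theorem kothe_summable_and_le {𝕜 : Type*} [RCLike 𝕜] {p : ℝ} (hp : 1 ≤ p) {u v : ℕ → 𝕜}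
    (hu : Summable fun j => ‖u j‖ ^ p) (hv : Summable fun j => ‖v j‖ ^ p) :
    Summable (fun j => ‖u j + v j‖ ^ p) ∧
      (∑' j, ‖u j + v j‖ ^ p) ^ (1 / p) ≤
        (∑' j, ‖u j‖ ^ p) ^ (1 / p) + (∑' j, ‖v j‖ ^ p) ^ (1 / p) := by
  have hp0 : 0 ≤ p := zero_le_one.trans hp
  obtain ⟨h1, h2⟩ := Real.Lp_add_le_tsum_of_nonneg hp (fun j => norm_nonneg (u j))
    (fun j => norm_nonneg (v j)) hu hv
  have hle : ∀ j, ‖u j + v j‖ ^ p ≤ (‖u j‖ + ‖v j‖) ^ p := fun j =>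
    Real.rpow_le_rpow (norm_nonneg _) (norm_add_le _ _) hp0
  have h3 : Summable (fun j => ‖u j + v j‖ ^ p) :=
    Summable.of_nonneg_of_le (fun j => Real.rpow_nonneg (norm_nonneg _) _) hle h1
  refine ⟨h3, le_trans ?_ h2⟩
  exact Real.rpow_le_rpow (tsum_nonneg fun j => Real.rpow_nonneg (norm_nonneg _) _)
    (h3.tsum_le_tsum hle h1) (by positivity)

/-- `λ_p(A, ℕ)` as a vector subspace of the space of all scalar sequences. -/
def kotheSubmodule (𝕜 : Type*) [RCLike 𝕜] (p : ℝ) (hp : p = 0 ∨ 1 ≤ p) (A : ℕ → ℕ → ℝ) :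
    Submodule 𝕜 (ℕ → 𝕜) where
  carrier := {x | KotheMem p A x}
  zero_mem' := by
    by_cases h : p = 0
    · simp [KotheMem, h]
    · simp [KotheMem, h, Real.zero_rpow h]
  add_mem' := by
    intro x y hx hy
    by_cases h : p = 0
    · simp only [Set.mem_ofPred_eq, KotheMem, h, if_true] at hx hy ⊢
      intro k
      simpa [mul_add] using (hx k).add (hy k)
    · simp only [Set.mem_ofPred_eq, KotheMem, h, if_false] at hx hy ⊢
      intro k
      simpa [mul_add] using (kothe_summable_and_le (hp.resolve_left h) (hx k) (hy k)).1
  smul_mem' := by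
    intro c x hx
    by_cases h : p = 0
    · simp only [Set.mem_ofPred_eq, KotheMem, h, if_true] at hx ⊢
      intro k
      simpa [mul_left_comm] using (hx k).const_mul c
    · simp only [Set.mem_ofPred_eq, KotheMem, h, if_false] at hx ⊢
      intro k
      have := (hx k).mul_left (‖c‖ ^ p)
      refine this.congr fun j => ?_
      rw [← Real.mul_rpow (norm_nonneg _) (norm_nonneg _), ← norm_mul, Pi.smul_apply, smul_eq_mul,
        mul_left_comm]

/-- The Köthe sequence space `λ_p(A, ℕ)`. This is a type of its own, which does not inherit the
topology of coordinatewise convergence. -/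
def KotheSpace (𝕜 : Type*) [RCLike 𝕜] (p : ℝ) (hp : p = 0 ∨ 1 ≤ p) (A : ℕ → ℕ → ℝ) : Type _ :=
  ↥(kotheSubmodule 𝕜 p hp A)

namespace KotheSpace

instance instAddCommGroup (𝕜 : Type*) [RCLike 𝕜] (p : ℝ) (hp : p = 0 ∨ 1 ≤ p)
    (A : ℕ → ℕ → ℝ) : AddCommGroup (KotheSpace 𝕜 p hp A) :=
  inferInstanceAs (AddCommGroup ↥(kotheSubmodule 𝕜 p hp A))

instance instModule (𝕜 : Type*) [RCLike 𝕜] (p : ℝ) (hp : p = 0 ∨ 1 ≤ p)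
    (A : ℕ → ℕ → ℝ) : Module 𝕜 (KotheSpace 𝕜 p hp A) :=
  inferInstanceAs (Module 𝕜 ↥(kotheSubmodule 𝕜 p hp A))

/-- The seminorms `‖·‖_k`, `k ∈ ℕ`, on `λ_p(A, ℕ)`. -/
def seminorms (𝕜 : Type*) [RCLike 𝕜] (p : ℝ) (hp : p = 0 ∨ 1 ≤ p) (A : ℕ → ℕ → ℝ) :
    SeminormFamily 𝕜 (KotheSpace 𝕜 p hp A) ℕ := fun k =>
  Seminorm.of (fun x => kotheNorm p A k x.1)
    (by
      rintro ⟨x, hx⟩ ⟨y, hy⟩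
      change kotheNorm p A k (x + y) ≤ kotheNorm p A k x + kotheNorm p A k y
      change KotheMem p A x at hx
      change KotheMem p A y at hy
      by_cases h : p = 0
      · simp only [KotheMem, kotheNorm, h, if_true] at hx hy ⊢
        refine ciSup_le fun j => ?_
        rw [Pi.add_apply, mul_add]
        exact (norm_add_le _ _).trans (add_le_add
          (le_ciSup (hx k).norm.bddAbove_range j) (le_ciSup (hy k).norm.bddAbove_range j))
      · simp only [KotheMem, kotheNorm, h, if_false] at hx hy ⊢
        simpa [mul_add] using (kothe_summable_and_le (hp.resolve_left h) (hx k) (hy k)).2)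
    (by
      rintro c ⟨x, hx⟩
      change kotheNorm p A k (c • x) = ‖c‖ * kotheNorm p A k x
      have hmul : ∀ j, ‖(A j k : 𝕜) * (c • x) j‖ = ‖c‖ * ‖(A j k : 𝕜) * x j‖ := fun j => by
        rw [Pi.smul_apply, smul_eq_mul, mul_left_comm, norm_mul]
      by_cases h : p = 0
      · simp only [kotheNorm, h, if_true, hmul]
        rw [Real.mul_iSup_of_nonneg (norm_nonneg c)]
      · simp only [kotheNorm, h, if_false, hmul]
        simp only [Real.mul_rpow (norm_nonneg _) (norm_nonneg _), tsum_mul_left]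
        rw [Real.mul_rpow (by positivity)
          (tsum_nonneg fun j => Real.rpow_nonneg (norm_nonneg _) _),
          ← Real.rpow_mul (norm_nonneg _), mul_one_div_cancel h, Real.rpow_one])

end KotheSpace

/-- The unilateral weighted backward shift `(x_j) ↦ (w_j x_{j+1})` on all scalar sequences. -/
def weightedShift {𝕜 : Type*} [RCLike 𝕜] (w : ℕ → 𝕜) : (ℕ → 𝕜) →ₗ[𝕜] (ℕ → 𝕜) where
  toFun x j := w j * x (j + 1)
  map_add' x y := by ext j; simp [mul_add]
  map_smul' c x := by ext j; simp [mul_left_comm]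

/-- The operator `B_w` on `λ_p(A, ℕ)`, when the weighted shift maps this space into itself. -/
def KotheSpace.shift {𝕜 : Type*} [RCLike 𝕜] {p : ℝ} {hp : p = 0 ∨ 1 ≤ p} {A : ℕ → ℕ → ℝ}
    (w : ℕ → 𝕜)
    (hB : ∀ x ∈ kotheSubmodule 𝕜 p hp A, weightedShift w x ∈ kotheSubmodule 𝕜 p hp A) :
    KotheSpace 𝕜 p hp A →ₗ[𝕜] KotheSpace 𝕜 p hp A :=
  (weightedShift w).restrict hB

end

/-! Coordinate `i` of the `n`-th iterate is `w_i ⋯ w_{i+n-1} x_{i+n}`. If for each `k` the quotients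
are bounded for some `ℓ`, the `k`-weighted entries of the iterate are dominated by a constant times
the `ℓ`-weighted entries of `x` from index `n` on; tails vanish, so all orbits tend to zero and no
Li–Yorke pair exists (`tendsto_shift_iterate_of_bounded`).

If they are unbounded for some `k`, choose sparse pairs `(i_m, j_m)` and put `1 / (a_{i_m,k}
|w_{i_m} ⋯ w_{j_m}|)` at coordinate `j_m + 1` (`exists_gliding_hump`). The `m`-th hump reaches `i_m`
with weighted size 1, yet after `j_m + 2` steps the humps up to `m` are gone and the rest is small.
The orbit thus approaches zero along a subsequence only, and the line through this vector is
scrambled. The continuity estimates needed come from invariance of the space, by the same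
construction. -/

/-! ### Domination and seminorms. -/

/-- The `ℓ_p` condition (`c₀` for `p = 0`) on a sequence of real numbers. -/
def IsLpBound (p : ℝ) (v : ℕ → ℝ) : Prop :=
  if p = 0 then Tendsto v atTop (𝓝 0) else Summable fun j => v j ^ p

theorem kotheMem_iff_isLpBound {𝕜 : Type*} [RCLike 𝕜] {p : ℝ} {A : ℕ → ℕ → ℝ} {x : ℕ → 𝕜} :
    KotheMem p A x ↔ ∀ k, IsLpBound p fun j => ‖(A j k : 𝕜) * x j‖ := by
  by_cases h : p = 0
  · simp only [KotheMem, IsLpBound, h, if_true]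
    exact forall_congr' fun k => tendsto_zero_iff_norm_tendsto_zero
  · simp only [KotheMem, IsLpBound, h, if_false]

theorem IsLpBound.const_mul {p : ℝ} {v : ℕ → ℝ} (h : IsLpBound p v) (hv : ∀ j, 0 ≤ v j)
    {C : ℝ} (hC : 0 ≤ C) : IsLpBound p fun j => C * v j := by
  unfold IsLpBound at *
  split_ifs at * with h0
  · simpa using Tendsto.const_mul C h
  · refine (h.mul_left (C ^ p)).congr fun j => ?_
    rw [Real.mul_rpow hC (hv j)]

theorem IsLpBound.of_eventually_le {p : ℝ} (hp : p = 0 ∨ 1 ≤ p) {u v : ℕ → ℝ}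
    (h : IsLpBound p v) (hu : ∀ j, 0 ≤ u j) (huv : ∀ᶠ j in atTop, u j ≤ v j) :
    IsLpBound p u := by
  unfold IsLpBound at *
  split_ifs at * with h0
  · exact squeeze_zero' (Eventually.of_forall hu) huv h
  · have hp0 : 0 ≤ p := zero_le_one.trans (hp.resolve_left h0)
    refine Summable.of_norm_bounded_eventually_nat h ?_
    filter_upwards [huv] with j hj
    rw [Real.norm_of_nonneg (Real.rpow_nonneg (hu j) p)]
    exact Real.rpow_le_rpow (hu j) hj hp0

theorem IsLpBound.tendsto_zero {p : ℝ} (hp : p = 0 ∨ 1 ≤ p) {v : ℕ → ℝ}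
    (h : IsLpBound p v) (hv : ∀ j, 0 ≤ v j) : Tendsto v atTop (𝓝 0) := by
  unfold IsLpBound at h
  split_ifs at h with h0
  · exact h
  · have hp0 : 0 < p := zero_lt_one.trans_le (hp.resolve_left h0)
    have h1 := h.tendsto_atTop_zero.rpow_const (p := 1 / p) (Or.inr (by positivity))
    rw [Real.zero_rpow (by positivity)] at h1
    refine h1.congr fun j => ?_
    rw [← Real.rpow_mul (hv j), mul_one_div_cancel h0, Real.rpow_one]

/-- Terms eventually below 1 satisfy `v ^ p ≤ v`, so one summable majorant serves every exponent. -/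
theorem Summable.isLpBound {p : ℝ} (hp : p = 0 ∨ 1 ≤ p) {v : ℕ → ℝ} (h : Summable v)
    (hv : ∀ j, 0 ≤ v j) : IsLpBound p v := by
  unfold IsLpBound
  split_ifs with h0
  · exact h.tendsto_atTop_zero
  · have hp1 : 1 ≤ p := hp.resolve_left h0
    refine Summable.of_norm_bounded_eventually_nat h ?_
    filter_upwards [h.tendsto_atTop_zero.eventually_lt_const zero_lt_one] with j hj
    rw [Real.norm_of_nonneg (Real.rpow_nonneg (hv j) p)]
    exact Real.rpow_le_self_of_le_one (hv j) hj.le hp1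

/-- Domination by the tails of an `ℓ_p` sequence forces the seminorms to tend to zero. -/
theorem tendsto_kotheNorm_of_le_tail {𝕜 ι : Type*} [RCLike 𝕜] {p : ℝ} (hp : p = 0 ∨ 1 ≤ p)
    {A : ℕ → ℕ → ℝ} {k : ℕ} {v : ℕ → ℝ} (h : IsLpBound p v) {F : Filter ι}
    {σ : ι → ℕ} (hσ : Tendsto σ F atTop) {y : ι → ℕ → 𝕜}
    (hy : ∀ᶠ m in F, ∀ j, ‖(A j k : 𝕜) * y m j‖ ≤ v (j + σ m)) :
    Tendsto (fun m => kotheNorm p A k (y m)) F (𝓝 0) := by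
  unfold IsLpBound at h
  simp only [kotheNorm]
  split_ifs at * with h0
  · rw [Metric.tendsto_nhds]
    intro ε hε
    obtain ⟨N, hN⟩ := eventually_atTop.1 (h.eventually_lt_const (half_pos hε))
    filter_upwards [hy, hσ.eventually_ge_atTop N] with m hm hN'
    have h1 : ⨆ j, ‖(A j k : 𝕜) * y m j‖ ≤ ε / 2 :=
      ciSup_le fun j => (hm j).trans (hN _ (by omega)).le
    have h2 : 0 ≤ ⨆ j, ‖(A j k : 𝕜) * y m j‖ := Real.iSup_nonneg fun j => norm_nonneg _
    rw [Real.dist_eq, sub_zero, abs_of_nonneg h2]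
    linarith
  · have hp1 : 1 ≤ p := hp.resolve_left h0
    have hp0 : 0 ≤ p := zero_le_one.trans hp1
    have h1 := ((tendsto_sum_nat_add fun j => v j ^ p).comp hσ).rpow_const (p := 1 / p)
      (Or.inr (by positivity))
    rw [Real.zero_rpow (by positivity)] at h1
    refine squeeze_zero' (Eventually.of_forall fun m =>
      Real.rpow_nonneg (tsum_nonneg fun j => Real.rpow_nonneg (norm_nonneg _) _) _) ?_ h1
    filter_upwards [hy] with m hm
    have hs : Summable fun j => v (j + σ m) ^ p := (summable_nat_add_iff (σ m)).2 h
    have hle : ∀ j, ‖(A j k : 𝕜) * y m j‖ ^ p ≤ v (j + σ m) ^ p := fun j =>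
      Real.rpow_le_rpow (norm_nonneg _) (hm j) hp0
    refine Real.rpow_le_rpow (tsum_nonneg fun j => Real.rpow_nonneg (norm_nonneg _) _)
      (Summable.tsum_le_tsum hle ?_ hs) (by positivity)
    exact Summable.of_nonneg_of_le (fun j => Real.rpow_nonneg (norm_nonneg _) _) hle hs

theorem norm_le_kotheNorm {𝕜 : Type*} [RCLike 𝕜] {p : ℝ} (hp : p = 0 ∨ 1 ≤ p)
    {A : ℕ → ℕ → ℝ} {x : ℕ → 𝕜} (hx : KotheMem p A x) (k j : ℕ) :
    ‖(A j k : 𝕜) * x j‖ ≤ kotheNorm p A k x := by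
  unfold KotheMem at hx
  unfold kotheNorm
  split_ifs at * with h0
  · exact le_ciSup (f := fun j => ‖(A j k : 𝕜) * x j‖) (hx k).norm.bddAbove_range j
  · have hp0 : 0 ≤ p := zero_le_one.trans (hp.resolve_left h0)
    have h1 := (hx k).le_tsum j fun i _ => Real.rpow_nonneg (norm_nonneg _) _
    have h2 := Real.rpow_le_rpow (Real.rpow_nonneg (norm_nonneg _) _) h1
      (show 0 ≤ 1 / p by positivity)
    rwa [← Real.rpow_mul (norm_nonneg _), mul_one_div_cancel h0, Real.rpow_one] at h2

theorem KotheMem.tendsto_zero {𝕜 : Type*} [RCLike 𝕜] {p : ℝ} (hp : p = 0 ∨ 1 ≤ p)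
    {A : ℕ → ℕ → ℝ} {x : ℕ → 𝕜} (hx : KotheMem p A x) (k : ℕ) :
    Tendsto (fun j => ‖(A j k : 𝕜) * x j‖) atTop (𝓝 0) :=
  (kotheMem_iff_isLpBound.1 hx k).tendsto_zero hp fun _ => norm_nonneg _

theorem IsKotheMatrix.mono {A : ℕ → ℕ → ℝ} (hA : IsKotheMatrix A) (j : ℕ) : Monotone (A j) :=
  monotone_nat_of_le_succ (hA.le_succ j)

/-! ### Iterates of the shift. -/

/-- The weight picked up at coordinate `i` by `n` applications of the weighted shift. -/
def shiftWeight {𝕜 : Type*} [RCLike 𝕜] (w : ℕ → 𝕜) (i n : ℕ) : 𝕜 :=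
  ∏ t ∈ Finset.range n, w (i + t)

theorem prod_Icc_eq_shiftWeight {𝕜 : Type*} [RCLike 𝕜] (w : ℕ → 𝕜) (i j : ℕ) :
    ∏ t ∈ Finset.Icc i j, w t = shiftWeight w i (j + 1 - i) := by
  rw [← Finset.Ico_add_one_right_eq_Icc, Finset.prod_Ico_eq_prod_range, shiftWeight]

theorem shiftWeight_ne_zero {𝕜 : Type*} [RCLike 𝕜] {w : ℕ → 𝕜} (hw : ∀ j, w j ≠ 0) (i n : ℕ) :
    shiftWeight w i n ≠ 0 :=
  Finset.prod_ne_zero_iff.2 fun _ _ => hw _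

theorem KotheSpace.shift_iterate_apply {𝕜 : Type*} [RCLike 𝕜] {p : ℝ} {hp : p = 0 ∨ 1 ≤ p}
    {A : ℕ → ℕ → ℝ} (w : ℕ → 𝕜)
    (hB : ∀ x ∈ kotheSubmodule 𝕜 p hp A, weightedShift w x ∈ kotheSubmodule 𝕜 p hp A)
    (n : ℕ) (x : KotheSpace 𝕜 p hp A) (i : ℕ) :
    ((KotheSpace.shift w hB)^[n] x).1 i = shiftWeight w i n * x.1 (i + n) := by
  induction n generalizing x with
  | zero => simp [shiftWeight]
  | succ n ih =>
    rw [Function.iterate_succ_apply, ih]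
    change shiftWeight w i n * (w (i + n) * x.1 (i + n + 1)) = _
    rw [shiftWeight, shiftWeight, Finset.prod_range_succ, mul_assoc, add_assoc]

/-- The `n`-th power of the weighted shift is bounded on unit vectors. -/
def ShiftBounded {𝕜 : Type*} [RCLike 𝕜] (A : ℕ → ℕ → ℝ) (w : ℕ → 𝕜) (n : ℕ) : Prop :=
  ∀ k, ∃ l, ∃ C : ℝ, 0 ≤ C ∧ ∀ i, A i k * ‖shiftWeight w i n‖ ≤ C * A (i + n) l

theorem shiftBounded_zero {𝕜 : Type*} [RCLike 𝕜] (A : ℕ → ℕ → ℝ) (w : ℕ → 𝕜) :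
    ShiftBounded A w 0 := fun k => ⟨k, 1, zero_le_one, fun i => by simp [shiftWeight]⟩

theorem ShiftBounded.all {𝕜 : Type*} [RCLike 𝕜] {A : ℕ → ℕ → ℝ} {w : ℕ → 𝕜}
    (h : ShiftBounded A w 1) (n : ℕ) : ShiftBounded A w n := by
  induction n with
  | zero => exact shiftBounded_zero A w
  | succ n ih =>
    intro k
    obtain ⟨l, C, hC, h1⟩ := ih k
    obtain ⟨l', C', hC', h2⟩ := h l
    refine ⟨l', C * C', mul_nonneg hC hC', fun i => ?_⟩
    have h3 := h2 (i + n)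
    simp only [shiftWeight, Finset.prod_range_one, add_zero] at h3
    have h4 := h1 i
    simp only [shiftWeight] at h4 ⊢
    rw [Finset.prod_range_succ, norm_mul]
    calc A i k * (‖∏ t ∈ Finset.range n, w (i + t)‖ * ‖w (i + n)‖)
        = (A i k * ‖∏ t ∈ Finset.range n, w (i + t)‖) * ‖w (i + n)‖ := by ring
      _ ≤ C * A (i + n) l * ‖w (i + n)‖ := mul_le_mul_of_nonneg_right h4 (norm_nonneg _)
      _ = C * (A (i + n) l * ‖w (i + n)‖) := by ring
      _ ≤ C * (C' * A (i + n + 1) l') := mul_le_mul_of_nonneg_left h3 hC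
      _ = C * C' * A (i + (n + 1)) l' := by rw [add_assoc]; ring

theorem KotheSpace.tendsto_zero_iff {𝕜 ι : Type*} [RCLike 𝕜] {p : ℝ} {hp : p = 0 ∨ 1 ≤ p}
    {A : ℕ → ℕ → ℝ} [TopologicalSpace (KotheSpace 𝕜 p hp A)]
    (htop : WithSeminorms (KotheSpace.seminorms 𝕜 p hp A)) {F : Filter ι}
    {u : ι → KotheSpace 𝕜 p hp A} :
    Tendsto u F (𝓝 0) ↔ ∀ k, Tendsto (fun m => kotheNorm p A k (u m).1) F (𝓝 0) := by
  rw [htop.tendsto_nhds u 0]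
  refine forall_congr' fun k => ?_
  rw [Metric.tendsto_nhds]
  refine forall_congr' fun ε => imp_congr_right fun _ => eventually_congr ?_
  refine Eventually.of_forall fun m => ?_
  have h0 : 0 ≤ kotheNorm p A k (u m).1 := apply_nonneg (KotheSpace.seminorms 𝕜 p hp A k) (u m)
  rw [sub_zero, Real.dist_eq, sub_zero, abs_of_nonneg h0]
  rfl

/-! ### Gliding humps and continuity of the shift. -/

/-- Taking maxima over finitely many powers lets the next hump be chosen against all earlier
requirements at once. -/
theorem exists_uniform_shift_bound {𝕜 : Type*} [RCLike 𝕜] {A : ℕ → ℕ → ℝ}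
    (hA : IsKotheMatrix A) {w : ℕ → 𝕜} {T : Set ℕ} (hT : ∀ n ∈ T, ShiftBounded A w n)
    (k M : ℕ) : ∃ l, ∃ N : ℝ, 0 ≤ N ∧ ∀ n ∈ T, n < M → ∀ q ≤ k, ∀ i,
      A i q * ‖shiftWeight w i n‖ ≤ N * A (i + n) l := by
  induction M with
  | zero => exact ⟨0, 0, le_rfl, fun n _ hn => absurd hn (Nat.not_lt_zero n)⟩
  | succ M ih =>
    obtain ⟨l, N, hN, h⟩ := ih
    by_cases hM : M ∈ T
    · obtain ⟨l', C, hC, h'⟩ := hT M hM k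
      refine ⟨max l l', max N C, hN.trans (le_max_left _ _), fun n hn hnM q hq i => ?_⟩
      rcases Nat.lt_succ_iff_lt_or_eq.1 hnM with hlt | rfl
      · exact (h n hn hlt q hq i).trans (mul_le_mul (le_max_left _ _)
          (hA.mono _ (le_max_left _ _)) (hA.nonneg _ _) (hN.trans (le_max_left _ _)))
      · exact (mul_le_mul_of_nonneg_right (hA.mono i hq) (norm_nonneg _)).trans
          ((h' i).trans (mul_le_mul (le_max_right _ _)
          (hA.mono _ (le_max_right _ _)) (hA.nonneg _ _) (hN.trans (le_max_left _ _))))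
    · refine ⟨l, N, hN, fun n hn hnM => h n hn ?_⟩
      have : n ≠ M := fun e => hM (e ▸ hn)
      omega

/-- A gliding hump: a vector of the Köthe space whose support sits at the coordinates
`b.2 + 1` of rapidly chosen pairs `b`, with entries `1 / ρ b`, and whose images under the powers
in `T` of the weighted shift have small tails. -/
theorem exists_gliding_hump {𝕜 : Type*} [RCLike 𝕜] {p : ℝ} (hp : p = 0 ∨ 1 ≤ p)
    {A : ℕ → ℕ → ℝ} (hA : IsKotheMatrix A) {w : ℕ → 𝕜} {T : Set ℕ} (hT0 : 0 ∈ T)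
    (hT : ∀ n ∈ T, ShiftBounded A w n) {P : ℕ × ℕ → Prop} {ρ : ℕ × ℕ → ℝ}
    (hρ : ∀ b, 0 < ρ b)
    (h : ∀ (l : ℕ) (N : ℝ) (J : ℕ), ∃ b, P b ∧ J < b.2 ∧ N * A (b.2 + 1) l < ρ b) :
    ∃ (s : ℕ → ℕ × ℕ) (x : ℕ → 𝕜) (g : ℕ → ℝ), (∀ m, P (s m)) ∧
      StrictMono (fun m => (s m).2) ∧ KotheMem p A x ∧
      (∀ m, x ((s m).2 + 1) = ((1 / ρ (s m) : ℝ) : 𝕜)) ∧ Summable g ∧ (∀ j, 0 ≤ g j) ∧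
      ∀ n ∈ T, ∀ m q i, n ≤ (s m).2 + 2 → q ≤ (s m).2 → (s m).2 + 2 ≤ i + n →
        ‖(A i q : 𝕜) * (shiftWeight w i n * x (i + n))‖ ≤ g (i + n) := by
  -- The relation says that hump `b`, seen through any power and seminorm active at stage `a`, has
  -- size at most `2 ^ (-a.2)`.
  obtain ⟨s, hs, hr⟩ := exists_seq_of_forall_finset_exists P
    (fun a b => a.2 < b.2 ∧ ∀ n ∈ T, n ≤ a.2 + 2 → ∀ q ≤ a.2, ∀ i, i + n = b.2 + 1 →
      2 ^ a.2 * (A i q * ‖shiftWeight w i n‖) ≤ ρ b) (by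
    intro S _
    obtain ⟨l, N, hN, hb⟩ := exists_uniform_shift_bound hA hT (S.sup Prod.snd)
      (S.sup Prod.snd + 3)
    obtain ⟨b, hPb, hJ, hbN⟩ := h l (2 ^ S.sup Prod.snd * N) (S.sup Prod.snd)
    refine ⟨b, hPb, fun a ha => ?_⟩
    have ha' : a.2 ≤ S.sup Prod.snd := Finset.le_sup (f := Prod.snd) ha
    refine ⟨ha'.trans_lt hJ, fun n hn hna q hq i hi => ?_⟩
    have h1 := hb n hn (by omega) q (hq.trans ha') i
    rw [hi] at h1
    refine le_trans ?_ hbN.le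
    rw [mul_assoc]
    exact mul_le_mul (pow_le_pow_right₀ one_le_two ha') h1
      (mul_nonneg (hA.nonneg _ _) (norm_nonneg _)) (by positivity))
  have hmono : StrictMono (fun m => (s m).2) := fun a b hab => (hr a b hab).1
  set φ : ℕ → ℕ := fun m => (s m).2 + 1 with hφ
  have hφm : StrictMono φ := fun a b hab => Nat.add_lt_add_right (hmono hab) 1
  set x : ℕ → 𝕜 := Function.extend φ (fun m => ((1 / ρ (s m) : ℝ) : 𝕜)) 0 with hx
  -- Hump `r + 1` is controlled by stage `r`, hence by `2 ^ (-r)`; the factor 2 absorbs this index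
  -- shift.
  set g : ℕ → ℝ := Function.extend φ (fun m => 2 * (1 / 2 : ℝ) ^ m) 0 with hg
  have hxφ : ∀ m, x (φ m) = ((1 / ρ (s m) : ℝ) : 𝕜) := fun m =>
    hφm.injective.extend_apply _ _ _
  have hgφ : ∀ m, g (φ m) = 2 * (1 / 2 : ℝ) ^ m := fun m => hφm.injective.extend_apply _ _ _
  have hgs : Summable g :=
    (summable_extend_zero hφm.injective).2 (summable_geometric_two.mul_left 2)
  have hg0 : ∀ j, 0 ≤ g j := by
    intro j
    by_cases hj : ∃ m, φ m = j
    · obtain ⟨m, rfl⟩ := hj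
      rw [hgφ]
      positivity
    · rw [hg, Function.extend_apply' _ _ _ hj]
      rfl
  have key : ∀ n ∈ T, ∀ m q i, n ≤ (s m).2 + 2 → q ≤ (s m).2 → (s m).2 + 2 ≤ i + n →
      ‖(A i q : 𝕜) * (shiftWeight w i n * x (i + n))‖ ≤ g (i + n) := by
    intro n hn m q i hnm hqm him
    by_cases hj : ∃ m', φ m' = i + n
    · obtain ⟨m', hm'⟩ := hj
      have hlt : m < m' := hφm.lt_iff_lt.1 (by rw [hm']; exact him)
      obtain ⟨r, rfl⟩ : ∃ r, m' = r + 1 := ⟨m' - 1, by omega⟩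
      have hmr : (s m).2 ≤ (s r).2 := hmono.monotone (Nat.lt_succ_iff.1 hlt)
      have h1 := (hr r (r + 1) (Nat.lt_succ_self r)).2 n hn (by omega) q (by omega) i hm'.symm
      have hpos := hρ (s (r + 1))
      have hrr : r ≤ (s r).2 := hmono.le_apply
      rw [← hm', hxφ, hgφ, norm_mul, norm_mul, RCLike.norm_ofReal, RCLike.norm_ofReal,
        abs_of_nonneg (hA.nonneg _ _), abs_of_pos (one_div_pos.2 hpos), ← mul_assoc, mul_one_div,
        div_le_iff₀ hpos]
      have h2 : (2 : ℝ) ^ r * (A i q * ‖shiftWeight w i n‖) ≤ ρ (s (r + 1)) :=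
        (mul_le_mul_of_nonneg_right (pow_le_pow_right₀ one_le_two hrr)
          (mul_nonneg (hA.nonneg _ _) (norm_nonneg _))).trans h1
      have h3 : 2 * (1 / 2 : ℝ) ^ (r + 1) * 2 ^ r = 1 := by
        rw [pow_succ, one_div, inv_pow]
        field_simp
      calc A i q * ‖shiftWeight w i n‖
          = 2 * (1 / 2 : ℝ) ^ (r + 1) * (2 ^ r * (A i q * ‖shiftWeight w i n‖)) := by
            rw [← mul_assoc, h3, one_mul]
        _ ≤ _ := mul_le_mul_of_nonneg_left h2 (by positivity)
    · rw [hx, Function.extend_apply' _ _ _ hj]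
      simpa using hg0 (i + n)
  refine ⟨s, x, g, hs, hmono, ?_, hxφ, hgs, hg0, key⟩
  rw [kotheMem_iff_isLpBound]
  intro q
  refine (hgs.isLpBound hp hg0).of_eventually_le hp (fun j => norm_nonneg _) ?_
  filter_upwards [eventually_ge_atTop ((s q).2 + 2)] with j hj
  simpa [shiftWeight] using key 0 hT0 q q j (Nat.zero_le _) hmono.le_apply hj

/-- Unbounded quotients are unbounded along pairs with arbitrarily large second entry. -/
theorem exists_large_quotient {A : ℕ → ℕ → ℝ} (hpos : ∀ j k, 0 < A j k) {ρ : ℕ × ℕ → ℝ}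
    {P : ℕ × ℕ → Prop} (hP : ∀ b, P b → b.1 ≤ b.2) {l : ℕ}
    (h : ∀ N : ℝ, ∃ b, P b ∧ N * A (b.2 + 1) l < ρ b) (N : ℝ) (J : ℕ) :
    ∃ b, P b ∧ J < b.2 ∧ N * A (b.2 + 1) l < ρ b := by
  -- Only finitely many pairs have both entries at most `J`; exceeding their largest quotient forces
  -- the second entry past `J`.
  obtain ⟨M, hM⟩ := ((Finset.range (J + 1) ×ˢ Finset.range (J + 1)).image
    fun b => ρ b / A (b.2 + 1) l).bddAbove
  obtain ⟨b, hb, hlt⟩ := h (max N M)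
  refine ⟨b, hb, ?_, (mul_le_mul_of_nonneg_right (le_max_left _ _) (hpos _ _).le).trans_lt hlt⟩
  by_contra hJ
  have h1 := hP b hb
  have h2 : ρ b / A (b.2 + 1) l ≤ M := hM (by
    simp only [Finset.coe_image, Set.mem_image, Finset.mem_coe, Finset.mem_product,
      Finset.mem_range]
    exact ⟨b, ⟨by omega, by omega⟩, rfl⟩)
  rw [div_le_iff₀ (hpos _ _)] at h2
  exact absurd hlt (not_lt.2 (h2.trans
    (mul_le_mul_of_nonneg_right (le_max_right _ _) (hpos _ _).le)))

/-- A weighted shift that maps the Köthe space into itself is bounded on unit vectors. -/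
theorem shiftBounded_one {𝕜 : Type*} [RCLike 𝕜] {p : ℝ} (hp : p = 0 ∨ 1 ≤ p)
    {A : ℕ → ℕ → ℝ} (hA : IsKotheMatrix A) (hpos : ∀ j k, 0 < A j k) {w : ℕ → 𝕜}
    (hw : ∀ j, w j ≠ 0)
    (hB : ∀ x ∈ kotheSubmodule 𝕜 p hp A, weightedShift w x ∈ kotheSubmodule 𝕜 p hp A) :
    ShiftBounded A w 1 := by
  by_contra hcon
  simp only [ShiftBounded, not_forall, not_exists, not_and, not_le] at hcon
  obtain ⟨k, hk⟩ := hcon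
  -- With `T = {0}` no continuity is presupposed: the construction only yields a vector of the
  -- space, whose image has weighted entries 1 infinitely often.
  obtain ⟨s, x, -, hs, hmono, hx, hxs, -⟩ := exists_gliding_hump hp hA (w := w)
    (T := {0}) rfl (fun n hn => by rw [Set.mem_singleton_iff.1 hn]; exact shiftBounded_zero A w)
    (P := fun b => b.1 = b.2) (ρ := fun b => A b.2 k * ‖w b.2‖)
    (fun b => mul_pos (hpos _ _) (norm_pos_iff.2 (hw _))) (fun l N J =>
      exists_large_quotient hpos (fun b hb => hb.le) (fun N => by
        obtain ⟨i, hi⟩ := hk l (max N 0) (le_max_right _ _)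
        refine ⟨(i, i), rfl, ?_⟩
        simp only [shiftWeight, Finset.prod_range_one, add_zero] at hi
        exact (mul_le_mul_of_nonneg_right (le_max_left _ _) (hpos _ _).le).trans_lt hi) N J)
  have h1 : Tendsto (fun j => ‖(A j k : 𝕜) * weightedShift w x j‖) atTop (𝓝 0) :=
    KotheMem.tendsto_zero hp (hB x hx) k
  have h2 := (h1.comp hmono.tendsto_atTop).eventually_lt_const zero_lt_one
  obtain ⟨m, hm⟩ := h2.exists
  refine absurd hm (not_lt.2 (le_of_eq ?_))
  change 1 = ‖(A (s m).2 k : 𝕜) * (w (s m).2 * x ((s m).2 + 1))‖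
  have hρ := mul_pos (hpos (s m).2 k) (norm_pos_iff.2 (hw (s m).2))
  rw [hxs, ← mul_assoc, norm_mul, norm_mul, RCLike.norm_ofReal, RCLike.norm_ofReal,
    abs_of_pos (hpos _ _), abs_of_pos (one_div_pos.2 hρ), mul_one_div_cancel hρ.ne']

/-! ### Behaviour of single orbits. -/

/-- If the weight quotients are unbounded, some orbit has a subsequence tending to zero but does
not tend to zero itself. -/
theorem exists_semi_irregular {𝕜 : Type*} [RCLike 𝕜] {p : ℝ} {hp : p = 0 ∨ 1 ≤ p}
    {A : ℕ → ℕ → ℝ} (hA : IsKotheMatrix A) (hpos : ∀ j k, 0 < A j k) {w : ℕ → 𝕜}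
    (hw : ∀ j, w j ≠ 0)
    (hB : ∀ x ∈ kotheSubmodule 𝕜 p hp A, weightedShift w x ∈ kotheSubmodule 𝕜 p hp A)
    {k : ℕ} (hk : ∀ l : ℕ, ∀ N : ℝ, ∃ i j : ℕ, i ≤ j ∧
      N * A (j + 1) l < A i k * ‖shiftWeight w i (j + 1 - i)‖) :
    ∃ x : KotheSpace 𝕜 p hp A,
      (∃ σ : ℕ → ℕ, Tendsto σ atTop atTop ∧ ∀ q, Tendsto
        (fun m => kotheNorm p A q ((KotheSpace.shift w hB)^[σ m] x).1) atTop (𝓝 0)) ∧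
      ¬ Tendsto (fun n => kotheNorm p A k ((KotheSpace.shift w hB)^[n] x).1) atTop (𝓝 0) := by
  obtain ⟨s, x, g, hs, hmono, hx, hxs, hgs, hg0, hg⟩ := exists_gliding_hump hp hA (w := w)
    (T := Set.univ) trivial (fun n _ => (shiftBounded_one hp hA hpos hw hB).all n)
    (P := fun b => b.1 ≤ b.2) (ρ := fun b => A b.1 k * ‖shiftWeight w b.1 (b.2 + 1 - b.1)‖)
    (fun b => mul_pos (hpos _ _) (norm_pos_iff.2 (shiftWeight_ne_zero hw _ _)))
    (fun l N J => exists_large_quotient hpos (fun b hb => hb) (fun N => by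
      obtain ⟨i, j, hij, h⟩ := hk l N
      exact ⟨(i, j), hij, h⟩) N J)
  obtain ⟨X, rfl⟩ : ∃ X : KotheSpace 𝕜 p hp A, X.1 = x := ⟨⟨x, hx⟩, rfl⟩
  refine ⟨X, ⟨fun m => (s m).2 + 2,
    (tendsto_add_atTop_nat 2).comp hmono.tendsto_atTop, fun q => ?_⟩, fun hlim => ?_⟩
  · refine tendsto_kotheNorm_of_le_tail hp (hgs.isLpBound hp hg0)
      ((tendsto_add_atTop_nat 2).comp hmono.tendsto_atTop) ?_
    filter_upwards [eventually_ge_atTop q] with m hm j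
    rw [KotheSpace.shift_iterate_apply]
    exact hg _ trivial m q j le_rfl (hm.trans hmono.le_apply) (Nat.le_add_left _ _)
  · obtain ⟨M, hM⟩ := eventually_atTop.1 (hlim.eventually_lt_const zero_lt_one)
    have hone : ∀ m, ‖(A (s m).1 k : 𝕜) *
        ((KotheSpace.shift w hB)^[(s m).2 + 1 - (s m).1] X).1 (s m).1‖ = 1 := by
      intro m
      have hle := hs m
      have hρ := mul_pos (hpos (s m).1 k)
        (norm_pos_iff.2 (shiftWeight_ne_zero hw (s m).1 ((s m).2 + 1 - (s m).1)))
      rw [KotheSpace.shift_iterate_apply,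
        show (s m).1 + ((s m).2 + 1 - (s m).1) = (s m).2 + 1 by omega]
      rw [hxs, ← mul_assoc, norm_mul, norm_mul, RCLike.norm_ofReal, RCLike.norm_ofReal,
        abs_of_pos (hpos _ _), abs_of_pos (one_div_pos.2 hρ), mul_one_div_cancel hρ.ne']
    -- The seminorm is at least 1 at these times, so convergence would bound them by `M`. Then the
    -- first entries of the pairs tend to infinity, while the finitely many iterates before `M` have
    -- weighted entries tending to zero.
    have hlt : ∀ m, (s m).2 + 1 - (s m).1 < M := by
      intro m
      by_contra hge
      have h1 := hM _ (not_lt.1 hge)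
      have h2 := norm_le_kotheNorm hp
        ((KotheSpace.shift w hB)^[(s m).2 + 1 - (s m).1] X).2 k (s m).1
      rw [hone] at h2
      exact absurd h1 (not_lt.2 h2)
    have hev : ∀ᶠ i in atTop, ∀ n ∈ Set.Iio M,
        ‖(A i k : 𝕜) * ((KotheSpace.shift w hB)^[n] X).1 i‖ < 1 :=
      (eventually_all_finite (Set.finite_Iio M)).2 fun n _ =>
        (KotheMem.tendsto_zero hp ((KotheSpace.shift w hB)^[n] X).2 k).eventually_lt_const
          zero_lt_one
    obtain ⟨I, hI⟩ := eventually_atTop.1 hev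
    have h1 : I + M ≤ (s (I + M)).2 := hmono.le_apply
    have h2 := hlt (I + M)
    have h3 := hI (s (I + M)).1 (by omega) _ h2
    rw [hone] at h3
    exact lt_irrefl _ h3

theorem tendsto_shift_iterate_of_bounded {𝕜 : Type*} [RCLike 𝕜] {p : ℝ} {hp : p = 0 ∨ 1 ≤ p}
    {A : ℕ → ℕ → ℝ} (hA : IsKotheMatrix A) {w : ℕ → 𝕜}
    (hB : ∀ x ∈ kotheSubmodule 𝕜 p hp A, weightedShift w x ∈ kotheSubmodule 𝕜 p hp A)
    {k l : ℕ} {C : ℝ} (hC : 0 ≤ C) (h : ∀ i j : ℕ, i ≤ j →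
      A i k * ‖shiftWeight w i (j + 1 - i)‖ ≤ C * A (j + 1) l) (x : KotheSpace 𝕜 p hp A) :
    Tendsto (fun n => kotheNorm p A k ((KotheSpace.shift w hB)^[n] x).1) atTop (𝓝 0) := by
  refine tendsto_kotheNorm_of_le_tail hp
    ((kotheMem_iff_isLpBound.1 x.2 l).const_mul (fun j => norm_nonneg _) hC) tendsto_id ?_
  -- The case `n = 0` is excluded because the hypothesis covers only nonempty products.
  filter_upwards [eventually_ge_atTop 1] with n hn i
  have h1 := h i (i + n - 1) (by omega)
  rw [show i + n - 1 + 1 - i = n by omega, show i + n - 1 + 1 = i + n by omega] at h1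
  rw [KotheSpace.shift_iterate_apply, ← mul_assoc, norm_mul, norm_mul, norm_mul (_ : 𝕜) (x.1 _),
    RCLike.norm_ofReal, RCLike.norm_ofReal, abs_of_nonneg (hA.nonneg _ _),
    abs_of_nonneg (hA.nonneg _ _), ← mul_assoc]
  exact mul_le_mul_of_nonneg_right h1 (norm_nonneg _)

/-! ### Li–Yorke pairs and the equivalence. -/

/-- For a translation-invariant metric, Li-Yorke pairs of a linear map are described by the orbit
of the difference. -/
theorem edist_iterate_eq_edist_sub_zero {𝕜 E : Type*} [RCLike 𝕜] [AddCommGroup E] [Module 𝕜 E]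
    [MetricSpace E] (hinv : ∀ x y z : E, dist (x + z) (y + z) = dist x y) (f : E →ₗ[𝕜] E)
    (x y : E) (n : ℕ) : edist (f^[n] x) (f^[n] y) = edist (f^[n] (x - y)) 0 := by
  rw [edist_dist, edist_dist, ← hinv (f^[n] (x - y)) 0 (f^[n] y), ← Module.End.coe_pow,
    map_sub, sub_add_cancel, zero_add]

theorem tendsto_zero_iff_limsup_edist {E : Type*} [MetricSpace E] [Zero E] (u : ℕ → E) :
    Tendsto u atTop (𝓝 0) ↔ limsup (fun n => edist (u n) 0) atTop = 0 := by
  rw [tendsto_iff_edist_tendsto_0]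
  refine ⟨fun h => h.limsup_eq, fun h => ?_⟩
  exact tendsto_of_le_liminf_of_limsup_le zero_le h.le

theorem theorem4p10 {𝕜 : Type*} [RCLike 𝕜] (p : ℝ) (hp : p = 0 ∨ 1 ≤ p)
    (A : ℕ → ℕ → ℝ) (hA : IsKotheMatrix A) (hA0 : ∀ j k, A j k ≠ 0)
    (w : ℕ → 𝕜) (hw : ∀ j, w j ≠ 0)
    (hB : ∀ x ∈ kotheSubmodule 𝕜 p hp A, weightedShift w x ∈ kotheSubmodule 𝕜 p hp A)
    -- any translation-invariant metric that induces the topology of the seminorms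
    [MetricSpace (KotheSpace 𝕜 p hp A)]
    (htop : WithSeminorms (KotheSpace.seminorms 𝕜 p hp A))
    (hinv : ∀ x y z : KotheSpace 𝕜 p hp A, dist (x + z) (y + z) = dist x y) :
    LiYorkeChaotic (KotheSpace.shift w hB) ↔
      ∃ k : ℕ, ∀ l : ℕ,
        ¬ BddAbove {r : ℝ | ∃ i j : ℕ, i ≤ j ∧
          r = A i k * ‖∏ t ∈ Finset.Icc i j, w t‖ / A (j + 1) l} := by
  have hpos : ∀ j k, 0 < A j k := fun j k => lt_of_le_of_ne (hA.nonneg j k) (hA0 j k).symm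
  simp only [prod_Icc_eq_shiftWeight]
  constructor
  · rintro ⟨S, hS, hLY⟩
    by_contra! hcon
    obtain ⟨x, hx, y, hy, hxy⟩ : S.Nontrivial :=
      Set.not_subsingleton_iff.1 fun h => hS h.countable
    have h2 := (hLY x hx y hy hxy).2
    simp only [edist_iterate_eq_edist_sub_zero hinv] at h2
    refine h2.ne' ((tendsto_zero_iff_limsup_edist _).1 ?_)
    rw [KotheSpace.tendsto_zero_iff htop]
    intro k
    obtain ⟨l, C, hC⟩ := hcon k
    refine tendsto_shift_iterate_of_bounded hA hB (l := l) (le_max_right C 0)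
      (fun i j hij => ?_) _
    have h3 := hC ⟨i, j, hij, rfl⟩
    rw [div_le_iff₀ (hpos _ _)] at h3
    exact h3.trans (mul_le_mul_of_nonneg_right (le_max_left _ _) (hpos _ _).le)
  · rintro ⟨k, hk⟩
    obtain ⟨x, ⟨σ, hσ, hx1⟩, hx2⟩ := exists_semi_irregular hA hpos hw hB (k := k) (by
      intro l N
      obtain ⟨_, ⟨i, j, hij, rfl⟩, hlt⟩ := not_bddAbove_iff.1 (hk l) N
      exact ⟨i, j, hij, (lt_div_iff₀ (hpos _ _)).1 hlt⟩)
    have hx0 : x ≠ 0 := by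
      rintro rfl
      refine hx2 ?_
      have h0 : ∀ n, (KotheSpace.shift w hB)^[n] 0 = 0 := fun n => by
        rw [← Module.End.coe_pow, map_zero]
      simp only [h0]
      have h1 : kotheNorm p A k (0 : KotheSpace 𝕜 p hp A).1 = 0 :=
        map_zero (KotheSpace.seminorms 𝕜 p hp A k)
      rw [h1]
      exact tendsto_const_nhds
    have hnorm : ∀ (c : 𝕜) (q n : ℕ), kotheNorm p A q ((KotheSpace.shift w hB)^[n] (c • x)).1
        = ‖c‖ * kotheNorm p A q ((KotheSpace.shift w hB)^[n] x).1 := fun c q n => by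
      rw [← Module.End.coe_pow, map_smul]
      exact map_smul_eq_mul (KotheSpace.seminorms 𝕜 p hp A q) c _
    have hinj : Function.Injective fun c : 𝕜 => c • x := fun c d hcd => by
      by_contra hne
      have h1 : (c - d) • x = 0 := by rw [sub_smul, sub_eq_zero]; exact hcd
      have h2 : x = (c - d)⁻¹ • ((c - d) • x) := by
        rw [smul_smul, inv_mul_cancel₀ (sub_ne_zero.2 hne), one_smul]
      exact hx0 (by rw [h2, h1, smul_zero])
    refine ⟨Set.range fun c : 𝕜 => c • x, fun hcount => ?_, ?_⟩
    · have h1 : (Set.univ : Set 𝕜).Countable := by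
        rw [← Set.image_univ] at hcount
        exact Set.countable_of_injective_of_countable_image hinj.injOn hcount
      have h2 : (Set.univ : Set ℝ).Countable :=
        Set.countable_of_injective_of_countable_image (f := ((↑) : ℝ → 𝕜))
          RCLike.ofReal_injective.injOn (h1.mono (Set.subset_univ _))
      exact Set.not_countable_univ h2
    -- Differences on the line are nonzero multiples of `x`, and scaling preserves both limit
    -- properties.
    · rintro _ ⟨c, rfl⟩ _ ⟨d, rfl⟩ hne
      have hcd : c - d ≠ 0 := fun h => hne (by rw [sub_eq_zero.1 h])
      simp only [IsLiYorkePair, edist_iterate_eq_edist_sub_zero hinv, ← sub_smul]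
      constructor
      · have h1 : Tendsto (fun m => (KotheSpace.shift w hB)^[σ m] ((c - d) • x)) atTop (𝓝 0) := by
          rw [KotheSpace.tendsto_zero_iff htop]
          intro q
          simp only [hnorm]
          simpa using (hx1 q).const_mul ‖c - d‖
        rw [tendsto_iff_edist_tendsto_0] at h1
        refine le_antisymm ?_ zero_le
        calc liminf (fun n => edist ((KotheSpace.shift w hB)^[n] ((c - d) • x)) 0) atTop
            ≤ liminf (fun n => edist ((KotheSpace.shift w hB)^[n] ((c - d) • x)) 0)
              (map σ atTop) := liminf_le_liminf_of_le hσ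
          _ = 0 := h1.liminf_eq
      · rw [pos_iff_ne_zero]
        intro h0
        have h1 := (KotheSpace.tendsto_zero_iff htop).1
          ((tendsto_zero_iff_limsup_edist _).2 h0) k
        simp only [hnorm] at h1
        refine hx2 ?_
        have h2 := h1.const_mul ‖c - d‖⁻¹
        simp only [inv_mul_cancel_left₀ (norm_ne_zero_iff.2 hcd), mul_zero] at h2
        exact h2
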